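/- A De Morgan algebra $\langle A;0,1,{\sim},\vee,\wedge\rangle$ is a bounded distributive lattice with a unary operation satisfying ${\sim}{\sim}x=x$ and ${\sim}(x\vee y)={\sim}x\wedge{\sim}y$; it is a Kleene algebra if moreover $x\wedge{\sim}x\le y\vee{\sim}y$ for all $x,y$. A monadic De Morgan algebra $\langle\mathfrak A,\nabla\rangle$ is a De Morgan algebra $\mathfrak A$ with a unary operation $\nabla$ (a quantifier) such that $\nabla 0=0$, $x\le\nabla x$, $\nabla(x\vee y)=\nabla x\vee\nabla y$, $\nabla(x\wedge\nabla y)=\nabla x\wedge\nabla y$ and $\nabla({\sim}\nabla x)={\sim}\nabla x$. The quantifier is of type 1 if there is an $a\in\mathfrak A$ with ${\sim}a=a$ such that $\nabla x=1$ if $x\not\le a$, $\nabla x=a$ if $0<x\le a$, and $\nabla 0=0$. Let $\mathcal M^{\nabla_0}$ be the variety of monadic De Morgan algebras satisfying $\nabla x\wedge{\sim}\nabla x=0$, let $\mathcal K^{\nabla}$ be the variety of monadic De Morgan algebras whose underlying De Morgan algebra is a Kleene algebra, and let $\mathcal M^{\nabla_{01}}$ be the variety of monadic De Morgan algebras satisfying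 $\nabla x\wedge{\sim}\nabla x\le\nabla y\vee{\sim}\nabla y$. Proposition. In the lattice of varieties of monadic De Morgan algebras, the join $\mathcal M^{\nabla_0}\vee\mathcal K^{\nabla}$ (the smallest variety containing both) is properly contained in $\mathcal M^{\nabla_{01}}$: \[ \mathcal M^{\nabla_0}\vee\mathcal K^{\nabla}\subsetneq\mathcal M^{\nabla_{01}}. \] Moreover, there is a simple six-element monadic De Morgan algebra $\langle\mathfrak A,\nabla\rangle$, with $\nabla$ a quantifier of type 1 and $\mathfrak A$ not a Kleene algebra, that belongs to $\mathcal M^{\nabla_{01}}$ but not to $\mathcal M^{\nabla_0}\vee\mathcal K^{\nabla}$. (Simple means nontrivial with no congruences other than equality and the total relation.) -/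

import Mathlib

universe u

/-- A De Morgan algebra `⟨A; 0, 1, ∼, ∨, ∧⟩`: a bounded distributive lattice with a unary
operation satisfying `∼∼x = x` and `∼(x ∨ y) = ∼x ∧ ∼y`. -/
class DeMorganAlgebra (A : Type u) extends DistribLattice A, BoundedOrder A where
  /-- The De Morgan negation `∼`. -/
  dneg : A → A
  dneg_dneg : ∀ x : A, dneg (dneg x) = x
  dneg_sup : ∀ x y : A, dneg (x ⊔ y) = dneg x ⊓ dneg y

/-- A monadic De Morgan algebra `⟨𝔄, ∇⟩`: a De Morgan algebra with an (existential) quantifier. -/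
class MonadicDeMorganAlgebra (A : Type u) extends DeMorganAlgebra A where
  /-- The quantifier `∇`. -/
  nabla : A → A
  nabla_bot : nabla ⊥ = ⊥
  le_nabla : ∀ x : A, x ≤ nabla x
  nabla_sup : ∀ x y : A, nabla (x ⊔ y) = nabla x ⊔ nabla y
  nabla_inf_nabla : ∀ x y : A, nabla (x ⊓ nabla y) = nabla x ⊓ nabla y
  nabla_dneg_nabla : ∀ x : A, nabla (dneg (nabla x)) = dneg (nabla x)

open DeMorganAlgebra MonadicDeMorganAlgebra

/-- A bundled monadic De Morgan algebra; the elements of this type form the variety `𝓜^∇`. -/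
structure MDMAlg : Type (u + 1) where
  carrier : Type u
  [str : MonadicDeMorganAlgebra carrier]

namespace MDMAlg

instance : CoeSort MDMAlg.{u} (Type u) := ⟨carrier⟩

instance (A : MDMAlg.{u}) : MonadicDeMorganAlgebra A := A.str

end MDMAlg

/-- Terms in the signature `⟨0, 1, ∼, ∨, ∧, ∇⟩` over countably many variables. -/
inductive MDMTerm : Type
  | var : ℕ → MDMTerm
  | zero : MDMTerm
  | one : MDMTerm
  | neg : MDMTerm → MDMTerm
  | join : MDMTerm → MDMTerm → MDMTerm
  | meet : MDMTerm → MDMTerm → MDMTerm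
  | quant : MDMTerm → MDMTerm

/-- The value of a term in a monadic De Morgan algebra under an assignment of the variables. -/
def MDMTerm.eval {A : Type u} [MonadicDeMorganAlgebra A] (v : ℕ → A) : MDMTerm → A
  | .var n => v n
  | .zero => ⊥
  | .one => ⊤
  | .neg s => dneg (s.eval v)
  | .join s t => s.eval v ⊔ t.eval v
  | .meet s t => s.eval v ⊓ t.eval v
  | .quant s => nabla (s.eval v)

/-- `A` satisfies the equation `e.1 ≈ e.2` (under every assignment of the variables). -/
def MDMAlg.Satisfies (A : MDMAlg.{u}) (e : MDMTerm × MDMTerm) : Prop :=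
  ∀ v : ℕ → A, e.1.eval v = e.2.eval v

/-- A variety of monadic De Morgan algebras (a subvariety of `𝓜^∇`): a class of monadic De Morgan
algebras that is defined by a set of equations. -/
@[ext]
structure MDMVariety : Type (u + 1) where
  carrier : Set MDMAlg.{u}
  equational : ∃ E : Set (MDMTerm × MDMTerm),
    ∀ A : MDMAlg.{u}, A ∈ carrier ↔ ∀ e ∈ E, A.Satisfies e

namespace MDMVariety

instance : Membership MDMAlg.{u} MDMVariety.{u} := ⟨fun V A => A ∈ V.carrier⟩

/-- Varieties are ordered by inclusion. -/
instance : PartialOrder MDMVariety.{u} :=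
  PartialOrder.lift carrier (fun _ _ h => MDMVariety.ext h)

/-- The meet of a family of varieties is its intersection. -/
instance : InfSet MDMVariety.{u} where
  sInf S :=
    { carrier := {A | ∀ V ∈ S, A ∈ V}
      equational := by
        refine ⟨{e | ∃ V ∈ S, ∀ A ∈ V, A.Satisfies e}, fun A => ⟨?_, ?_⟩⟩
        · rintro hA e ⟨V, hV, he⟩
          exact he A (hA V hV)
        · intro hA V hV
          obtain ⟨E, hE⟩ := V.equational
          exact (hE A).2 fun e he => hA e ⟨V, hV, fun B hB => (hE B).1 hB e he⟩ }

/-- The lattice of subvarieties of `𝓜^∇`. In particular `V ⊔ W` is the join of `V` and `W`, the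
smallest variety that contains both. -/
instance : CompleteLattice MDMVariety.{u} :=
  completeLatticeOfInf MDMVariety.{u} fun _ =>
    ⟨fun _ hV _ hA => hA _ hV, fun _ hW _ hA _ hV => hW hV hA⟩

end MDMVariety

/-- A Kleene algebra is a De Morgan algebra with `x ∧ ∼x ≤ y ∨ ∼y`. -/
def IsKleene (A : Type u) [DeMorganAlgebra A] : Prop :=
  ∀ x y : A, x ⊓ dneg x ≤ y ⊔ dneg y

/-- `𝓜^{∇₀}`: the monadic De Morgan algebras with `∇x ∧ ∼∇x = 0`. -/
def varietyM0 : MDMVariety.{u} where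
  carrier := {A | ∀ x : A, nabla x ⊓ dneg (nabla x) = ⊥}
  equational :=
    ⟨{(.meet (.quant (.var 0)) (.neg (.quant (.var 0))), .zero)}, fun A => by
      simp only [Set.mem_ofPred_eq, Set.mem_singleton_iff, forall_eq, MDMAlg.Satisfies,
        MDMTerm.eval]
      exact ⟨fun h v => h (v 0), fun h x => h fun _ => x⟩⟩

/-- `𝓚^∇`: the monadic Kleene algebras. -/
def varietyK : MDMVariety.{u} where
  carrier := {A | IsKleene A}
  equational :=
    ⟨{(.meet (.meet (.var 0) (.neg (.var 0))) (.join (.var 1) (.neg (.var 1))),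
        .meet (.var 0) (.neg (.var 0)))}, fun A => by
      simp only [Set.mem_ofPred_eq, Set.mem_singleton_iff, forall_eq, MDMAlg.Satisfies,
        MDMTerm.eval, inf_eq_left, IsKleene]
      exact ⟨fun h v => h (v 0) (v 1), fun h x y => h fun n => if n = 0 then x else y⟩⟩

/-- `𝓜^{∇₀₁}`: the monadic De Morgan algebras with `∇x ∧ ∼∇x ≤ ∇y ∨ ∼∇y`. -/
def varietyM01 : MDMVariety.{u} where
  carrier := {A | ∀ x y : A, nabla x ⊓ dneg (nabla x) ≤ nabla y ⊔ dneg (nabla y)}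
  equational :=
    ⟨{(.meet (.meet (.quant (.var 0)) (.neg (.quant (.var 0))))
          (.join (.quant (.var 1)) (.neg (.quant (.var 1)))),
        .meet (.quant (.var 0)) (.neg (.quant (.var 0))))}, fun A => by
      simp only [Set.mem_ofPred_eq, Set.mem_singleton_iff, forall_eq, MDMAlg.Satisfies,
        MDMTerm.eval, inf_eq_left]
      exact ⟨fun h v => h (v 0) (v 1), fun h x y => h fun n => if n = 0 then x else y⟩⟩

/-- The quantifier of `A` is of type 1: for some fixed point `a = ∼a`, the value `∇x` is `1` if
`x ≰ a`, is `a` if `0 < x ≤ a`, and is `0` if `x = 0`. -/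
def IsTypeOne (A : Type u) [MonadicDeMorganAlgebra A] : Prop :=
  ∃ a : A, dneg a = a ∧ (∀ x : A, ¬ x ≤ a → nabla x = ⊤) ∧
    (∀ x : A, ⊥ < x → x ≤ a → nabla x = a) ∧ nabla (⊥ : A) = ⊥

/-- A congruence of a monadic De Morgan algebra: an equivalence relation that is compatible with
all the operations. -/
structure IsMDMCongruence {A : Type u} [MonadicDeMorganAlgebra A] (r : A → A → Prop) : Prop where
  equivalence : Equivalence r
  sup : ∀ {x x' y y' : A}, r x x' → r y y' → r (x ⊔ y) (x' ⊔ y')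
  inf : ∀ {x x' y y' : A}, r x x' → r y y' → r (x ⊓ y) (x' ⊓ y')
  dneg : ∀ {x x' : A}, r x x' → r (DeMorganAlgebra.dneg x) (DeMorganAlgebra.dneg x')
  nabla : ∀ {x x' : A}, r x x' →
    r (MonadicDeMorganAlgebra.nabla x) (MonadicDeMorganAlgebra.nabla x')

/-- `A` is simple: it is nontrivial, and its only congruences are equality and the total
relation. -/
def IsSimpleMDM (A : Type u) [MonadicDeMorganAlgebra A] : Prop :=
  Nontrivial A ∧ ∀ r : A → A → Prop, IsMDMCongruence r →
    (∀ x y : A, r x y → x = y) ∨ (∀ x y : A, r x y)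

/-! The join is separated from `varietyM01` by one equation, ∇x ∧ ∼∇x ∧ y ∧ ∼y ≤ z ∨ ∼z. It weakens
both defining conditions: under that of `varietyM0` the left side is 0, and under that of `varietyK`
the factor y ∧ ∼y is already below z ∨ ∼z. As it defines a variety, it holds throughout the join. It
fails in a six-element algebra whose negation has two incomparable fixed points a and b, with ∇ of
type 1 at a: x = y = a and z = b would give a ≤ b. The algebra is still in `varietyM01`, because
that condition sees only the range {0, a, 1} of ∇, which is a Kleene chain. -/

/-- The monadic De Morgan algebras with `∇x ∧ ∼∇x ∧ y ∧ ∼y ≤ z ∨ ∼z`. -/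
def varietyNablaKleene : MDMVariety.{u} where
  carrier := {A | ∀ x y z : A,
    nabla x ⊓ dneg (nabla x) ⊓ (y ⊓ dneg y) ≤ z ⊔ dneg z}
  equational :=
    ⟨{(.meet (.meet (.meet (.quant (.var 0)) (.neg (.quant (.var 0))))
            (.meet (.var 1) (.neg (.var 1))))
          (.join (.var 2) (.neg (.var 2))),
        .meet (.meet (.quant (.var 0)) (.neg (.quant (.var 0))))
          (.meet (.var 1) (.neg (.var 1))))}, fun A => by
      simp only [Set.mem_ofPred_eq, Set.mem_singleton_iff, forall_eq, MDMAlg.Satisfies,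
        MDMTerm.eval, inf_eq_left]
      exact ⟨fun h v => h (v 0) (v 1) (v 2),
        fun h x y z => h fun n => if n = 0 then x else if n = 1 then y else z⟩⟩

theorem varietyM0_sup_varietyK_le_varietyNablaKleene :
    (varietyM0 ⊔ varietyK : MDMVariety.{u}) ≤ varietyNablaKleene := by
  refine sup_le (fun A hA x y z => ?_) (fun A hA x y z => inf_le_right.trans (hA y z))
  rw [show nabla x ⊓ dneg (nabla x) = ⊥ from hA x, bot_inf_eq]
  exact bot_le

theorem varietyM0_sup_varietyK_le_varietyM01 :
    (varietyM0 ⊔ varietyK : MDMVariety.{u}) ≤ varietyM01 := by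
  refine sup_le (fun A hA x y => ?_) (fun A hA x y => hA (nabla x) (nabla y))
  rw [show nabla x ⊓ dneg (nabla x) = ⊥ from hA x]
  exact bot_le

/-- The six-element lattice `0 < c < a, b < d < 1` with `a`, `b` incomparable. -/
inductive Hexad : Type u
  | zero | c | a | b | d | one
  deriving DecidableEq

namespace Hexad

instance : Fintype Hexad.{u} where
  elems := {zero, c, a, b, d, one}
  complete x := by cases x <;> decide

/-- The embedding of the six-element lattice into a product of two chains. -/
def toProd : Hexad.{u} → Fin 4 × Fin 4
  | zero => (0, 0)
  | c => (1, 1)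
  | a => (2, 1)
  | b => (1, 2)
  | d => (2, 2)
  | one => (3, 3)

theorem toProd_injective : Function.Injective toProd.{u} := by
  intro x y
  cases x <;> cases y <;> decide

/-- The join of the six-element lattice. -/
def join : Hexad.{u} → Hexad.{u} → Hexad.{u}
  | zero, y => y
  | x, zero => x
  | one, _ => one
  | _, one => one
  | c, y => y
  | x, c => x
  | a, a => a
  | b, b => b
  | _, _ => d

/-- The De Morgan negation, fixing both `a` and `b`. -/
def neg : Hexad.{u} → Hexad.{u}
  | zero => one
  | c => d
  | a => a
  | b => b
  | d => c
  | one => zero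

/-- The meet of the six-element lattice. -/
def meet (x y : Hexad.{u}) : Hexad.{u} := neg (join (neg x) (neg y))

/-- The quantifier of type 1 determined by the fixed point `a`. -/
def quant : Hexad.{u} → Hexad.{u}
  | zero => zero
  | c => a
  | a => a
  | b => one
  | d => one
  | one => one

instance : LE Hexad.{u} := ⟨fun x y => toProd x ≤ toProd y⟩
instance : LT Hexad.{u} := ⟨fun x y => toProd x < toProd y⟩
instance : Max Hexad.{u} := ⟨join⟩
instance : Min Hexad.{u} := ⟨meet⟩

instance : DecidableLE Hexad.{u} := fun x y =>
  inferInstanceAs (Decidable (toProd x ≤ toProd y))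
instance : DecidableLT Hexad.{u} := fun x y =>
  decidable_of_iff (toProd x ≤ toProd y ∧ ¬ toProd y ≤ toProd x) lt_iff_le_not_ge.symm

/-- Distributivity is inherited from the product of chains, of which `toProd` makes this a
sublattice. -/
noncomputable instance : DistribLattice Hexad.{u} :=
  toProd_injective.distribLattice toProd Iff.rfl Iff.rfl
    (fun x y => by cases x <;> cases y <;> decide)
    (fun x y => by cases x <;> cases y <;> decide)

noncomputable instance : DeMorganAlgebra Hexad.{u} where
  top := one
  le_top x := by cases x <;> decide
  bot := zero
  bot_le x := by cases x <;> decide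
  dneg := neg
  dneg_dneg x := by cases x <;> rfl
  dneg_sup x y := by cases x <;> cases y <;> rfl

noncomputable instance : MonadicDeMorganAlgebra Hexad.{u} where
  nabla := quant
  nabla_bot := rfl
  le_nabla x := by cases x <;> decide
  nabla_sup x y := by cases x <;> cases y <;> rfl
  nabla_inf_nabla x y := by cases x <;> cases y <;> rfl
  nabla_dneg_nabla x := by cases x <;> rfl

theorem card_eq_six : Nat.card Hexad.{u} = 6 := by
  rw [Nat.card_eq_fintype_card]
  rfl

theorem isTypeOne : IsTypeOne Hexad.{u} := by
  refine ⟨a, rfl, fun x => ?_, fun x => ?_, rfl⟩ <;> cases x <;> decide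

theorem not_isKleene : ¬ IsKleene Hexad.{u} := fun h =>
  absurd (h a b) (by decide)

/-- The pair (∇x, ∇∼x) determines x, so a congruence identifying two distinct elements identifies
two of 0, a, 1. Since ∼ fixes a and swaps 0 and 1, it then identifies 0 with 1 and is total. -/
theorem isSimpleMDM : IsSimpleMDM Hexad.{u} := by
  refine ⟨⟨zero, one, by decide⟩, fun r hr => ?_⟩
  have total_of_zero_one (h : r zero one) (x y : Hexad.{u}) : r x y := by
    have key (z : Hexad.{u}) : r zero z := by
      -- Meeting 0 ~ 1 with z gives 0 ~ z.
      have := hr.inf h (hr.equivalence.refl z)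
      cases z <;> exact this
    exact hr.equivalence.trans (hr.equivalence.symm (key x)) (key y)
  have total_of_a_one (h : r a one) : r zero one :=
    hr.equivalence.trans (hr.dneg (hr.equivalence.symm h)) h
  have total_of_zero_a (h : r zero a) : r zero one :=
    hr.equivalence.trans h (hr.equivalence.symm (hr.dneg h))
  by_contra! hne
  obtain ⟨⟨x, y, hxy, hxy'⟩, hnot⟩ := hne
  have hn : ¬ r zero one := fun h => by
    obtain ⟨x, y, h'⟩ := hnot
    exact h' (total_of_zero_one h x y)
  have ha : ¬ r a one := fun h => hn (total_of_a_one h)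
  have hz : ¬ r zero a := fun h => hn (total_of_zero_a h)
  -- For each pair x ≠ y, ∇ or ∇∼ takes distinct values in {0, a, 1}, contradicting `hn`, `ha` or
  -- `hz`.
  have h1 := hr.nabla hxy
  have h2 := hr.nabla (hr.dneg hxy)
  have h1' := hr.equivalence.symm h1
  have h2' := hr.equivalence.symm h2
  cases x <;> cases y <;>
    first
    | exact hxy' rfl
    | exact hn h1
    | exact hn h1'
    | exact ha h1
    | exact ha h1'
    | exact hz h1
    | exact hz h1'
    | exact ha h2
    | exact ha h2'
    | exact hn h2
    | exact hn h2'
    | exact hz h2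
    | exact hz h2'

theorem mem_varietyM01 : (⟨Hexad⟩ : MDMAlg.{u}) ∈ (varietyM01 : MDMVariety.{u}) := by
  change ∀ x y : Hexad.{u}, nabla x ⊓ dneg (nabla x) ≤ nabla y ⊔ dneg (nabla y)
  intro x y
  cases x <;> cases y <;> decide

theorem notMem_varietyNablaKleene :
    (⟨Hexad⟩ : MDMAlg.{u}) ∉ (varietyNablaKleene : MDMVariety.{u}) := fun h =>
  absurd (show nabla (a : Hexad.{u}) ⊓ dneg (nabla a) ⊓ (a ⊓ dneg a) ≤ b ⊔ dneg b from h a a b)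
    (by decide)

theorem notMem_varietyM0_sup_varietyK :
    (⟨Hexad⟩ : MDMAlg.{u}) ∉ (varietyM0 ⊔ varietyK : MDMVariety.{u}) := fun h =>
  notMem_varietyNablaKleene (varietyM0_sup_varietyK_le_varietyNablaKleene h)

end Hexad

theorem mainTheorem6 :
    (varietyM0 ⊔ varietyK : MDMVariety.{u}) < varietyM01 ∧
      ∃ A : MDMAlg.{u}, Nat.card A = 6 ∧ IsSimpleMDM A ∧ IsTypeOne A ∧ ¬ IsKleene A ∧
        A ∈ (varietyM01 : MDMVariety.{u}) ∧ A ∉ (varietyM0 ⊔ varietyK : MDMVariety.{u}) :=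
  ⟨lt_of_le_not_ge varietyM0_sup_varietyK_le_varietyM01 fun h =>
      Hexad.notMem_varietyM0_sup_varietyK (h Hexad.mem_varietyM01),
    ⟨Hexad⟩, Hexad.card_eq_six, Hexad.isSimpleMDM, Hexad.isTypeOne, Hexad.not_isKleene,
    Hexad.mem_varietyM01, Hexad.notMem_varietyM0_sup_varietyK⟩
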